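/- Let $p$ be an odd prime, let $n\ge 2$, and let $L/K$ be a separable field extension of degree $p^n$ with normal closure $\widetilde L$. A Hopf Galois structure on $L/K$ is a finite cocommutative $K$-Hopf algebra $H$ together with a $K$-linear action of $H$ on $L$ that makes $L$ a left $H$-module algebra and for which the induced $K$-linear map $L\otimes_K H\to \mathrm{End}_K(L)$, $x\otimes h\mapsto (y\mapsto x\,(h\cdot y))$, is bijective. Such a structure has type $N$, where $N$ is a group, if $\widetilde L\otimes_K H\cong \widetilde L[N]$ as $\widetilde L$-Hopf algebras (equivalently, if $N$ is isomorphic to the group that corresponds to the structure under the Greither–Pareigis correspondence). If $L/K$ has a Hopf Galois structure of type $C_{p^n}$, the cyclic group of order $p^n$, then $L/K$ has no Hopf Galois structure of type $N$ for any noncyclic group $N$. -/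

import Mathlib

open scoped TensorProduct

universe w w' uK uL uE uN

/-- A Hopf Galois structure on `L / K` with Hopf algebra `H`: `H` is a finite cocommutative
`K`-Hopf algebra with a `K`-linear action on `L` making `L` a left `H`-module algebra, such that
the induced map `L ⊗ H → End_K(L)` is an isomorphism of `K`-vector spaces. -/
structure HopfGaloisStructure (K L H : Type*) [Field K] [Field L] [Algebra K L]
    [Ring H] [HopfAlgebra K H] where
  /-- `H` is finite over `K`. -/
  finite : Module.Finite K H
  /-- `H` is cocommutative. -/
  cocomm : Coalgebra.IsCocomm K H
  /-- The action of `H` on `L`; being an algebra homomorphism, it makes `L` a left `H`-module. -/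
  act : H →ₐ[K] Module.End K L
  /-- `h · (x y) = ∑ (h₁ · x) (h₂ · y)`, where `Δ(h) = ∑ h₁ ⊗ h₂`. -/
  act_mul : ∀ (h : H) (x y : L), act h (x * y) =
    LinearMap.mul' K L (TensorProduct.map (act.toLinearMap.flip x) (act.toLinearMap.flip y)
      (Coalgebra.comul (R := K) h))
  /-- `h · 1 = ε(h) 1`. -/
  act_one : ∀ h : H, act h 1 = algebraMap K L (Coalgebra.counit (R := K) h)
  /-- The map `L ⊗ H → End_K(L)`, `x ⊗ h ↦ (y ↦ x (h · y))`, is bijective. -/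
  bijective : Function.Bijective (TensorProduct.lift
    ((LinearMap.mul K (Module.End K L)).compl₁₂
      (Algebra.lmul K L).toLinearMap act.toLinearMap) : L ⊗[K] H →ₗ[K] Module.End K L)

/-- `L / K`, with normal closure `E`, has a Hopf Galois structure of type `N`: there is a
Hopf Galois structure on `L / K` whose Hopf algebra `H` becomes, after extending scalars to `E`,
the group algebra `E[N]` with its usual Hopf algebra structure. (An isomorphism of bialgebras
between Hopf algebras preserves antipodes. The group `N` is determined up to isomorphism as the
group of group-like elements of `E ⊗ H`; by Galois descent it is the group `N` for which `H` is the
fixed algebra `E[N]^G`, `G = Gal(E / K)`.) -/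
def HasHopfGaloisStructureOfType (K : Type uK) (L : Type uL) (E : Type uE)
    [Field K] [Field L] [Algebra K L] [Field E] [Algebra K E] (N : Type uN) [Group N] : Prop :=
  ∃ (H : Type w) (_ : Ring H) (_ : HopfAlgebra K H),
    Nonempty (HopfGaloisStructure K L H) ∧
      Nonempty ((E ⊗[K] H) ≃ₐc[E] MonoidAlgebra E N)

/-! Following Greither and Pareigis, let `X` be the set of embeddings `L →ₐ[K] E`. It has `p ^ n`
elements and `Gal(E/K)` acts on it transitively. Grouplike elements of `E ⊗ H` act on `X`, so a
structure of type `N` gives a regular action of `N` normalized by the Galois group. The claim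
becomes one about permutation groups (`isCyclic_of_normalizes_regular_cyclic`).

If a transitive `G` normalizes a regular cyclic group, its Sylow `p`-subgroups are transitive, so
one contains a `g` acting as `c ↦ u c + 1` on `ZMod (p ^ n)`. Lifting the exponent for odd `p` shows
that `g` alone is transitive (`exists_transitive_element`).

If `g` also normalizes a regular `N`, it induces an affine map `v ↦ A v + v₀` on the Frattini
quotient, of rank `d`, and the orbit of 0 is everything. For `d ≥ 2` this is impossible: `A` is
unipotent and `1 + A + ... + A ^ (q - 1) = (A - 1) ^ (q - 1) = 0` for `q = p ^ (d - 1)`, so the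
orbit has at most `q` points (`finrank_lt_two_of_affine_orbit`). Hence `d ≤ 1` and `N` is cyclic. -/

/-! ### Unipotent affine maps over `ZMod p` -/

section LinearAlgebra

open Polynomial in
theorem Polynomial.geom_sum_X_eq_sub_one_pow (p : ℕ) [hp : Fact p.Prime] (m : ℕ) :
    ∑ i ∈ Finset.range (p ^ m), (X : (ZMod p)[X]) ^ i = (X - 1) ^ (p ^ m - 1) := by
  have h1 : (X - 1 : (ZMod p)[X]) ≠ 0 := X_sub_C_ne_zero (1 : ZMod p)
  apply mul_right_cancel₀ h1
  rw [geom_sum_mul, ← pow_succ, Nat.sub_add_cancel (Nat.one_le_pow _ _ hp.out.pos),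
    sub_pow_char_pow, one_pow]

variable {p : ℕ} [hp : Fact p.Prime] {V : Type*} [AddCommGroup V] [Module (ZMod p) V]

theorem natCard_eq_prime_pow_finrank [Finite V] :
    Nat.card V = p ^ Module.finrank (ZMod p) V := by
  rw [Module.natCard_eq_pow_finrank (K := ZMod p), Nat.card_zmod]

theorem Module.End.sub_one_pow_prime_pow (A : Module.End (ZMod p) V) (m : ℕ) :
    (A - 1) ^ (p ^ m) = A ^ (p ^ m) - 1 := by
  have h : (Polynomial.X - 1 : Polynomial (ZMod p)) ^ (p ^ m) = Polynomial.X ^ (p ^ m) - 1 := by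
    rw [sub_pow_char_pow, one_pow]
  simpa using congrArg (Polynomial.aeval A) h

theorem Module.End.geom_sum_eq_sub_one_pow (A : Module.End (ZMod p) V) (m : ℕ) :
    ∑ i ∈ Finset.range (p ^ m), A ^ i = (A - 1) ^ (p ^ m - 1) := by
  simpa using congrArg (Polynomial.aeval A) (Polynomial.geom_sum_X_eq_sub_one_pow p m)

/-- `A - 1` is nilpotent by Frobenius, and the kernels of its powers stabilize by the rank. -/
theorem Module.End.sub_one_pow_eq_zero [FiniteDimensional (ZMod p) V]
    (A : Module.End (ZMod p) V) (M : ℕ) (hA : A ^ (p ^ M) = 1) {k : ℕ}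
    (hk : Module.finrank (ZMod p) V ≤ k) : (A - 1) ^ k = 0 := by
  have h0 : (A - 1) ^ (p ^ M) = 0 := by rw [A.sub_one_pow_prime_pow, hA, sub_self]
  have h1 : (A - 1) ^ (p ^ M + Module.finrank (ZMod p) V) = 0 := by rw [pow_add, h0, zero_mul]
  have h2 := Module.End.ker_pow_eq_ker_pow_finrank_of_le (f := A - 1)
    (Nat.le_add_left (Module.finrank (ZMod p) V) (p ^ M))
  rw [h1, LinearMap.ker_zero] at h2
  exact pow_eq_zero_of_le hk (LinearMap.ker_eq_top.1 h2.symm)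

/-- An affine map of `p`-power order (`p` odd) on an elementary abelian `p`-group of rank at
least two does not act transitively. -/
theorem finrank_lt_two_of_affine_orbit (hodd : p ≠ 2) [Finite V]
    (A : Module.End (ZMod p) V) (M : ℕ) (hA : A ^ (p ^ M) = 1) (v : V) (c : ℕ → V)
    (h0 : c 0 = 0) (hs : ∀ k, c (k + 1) = A (c k) + v) (hc : Function.Surjective c) :
    Module.finrank (ZMod p) V < 2 := by
  by_contra! hd
  obtain ⟨m, hm⟩ : ∃ m, Module.finrank (ZMod p) V = m + 1 := ⟨_, (Nat.sub_add_cancel (by omega)).symm⟩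
  have hp3 : 3 ≤ p := by have := hp.out.two_le; omega
  -- Oddness of `p` enters here: `p ^ m - 1` must reach the rank `m + 1`, which fails for `p = 2`,
  -- `m = 1`.
  have hle : m + 2 ≤ p ^ m := by
    have h3 : (3 : ℕ) ^ m ≤ p ^ m := Nat.pow_le_pow_left hp3 m
    have h1 : ∀ k : ℕ, k * 2 + 1 ≤ 3 ^ k := by
      intro k
      induction k with
      | zero => simp
      | succ k ih => rw [pow_succ]; omega
    have := h1 m
    omega
  have hAm : A ^ (p ^ m) = 1 := by
    rw [← sub_eq_zero, ← A.sub_one_pow_prime_pow]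
    exact A.sub_one_pow_eq_zero M hA (by omega)
  have hsum : ∑ i ∈ Finset.range (p ^ m), A ^ i = 0 := by
    rw [A.geom_sum_eq_sub_one_pow]
    exact A.sub_one_pow_eq_zero M hA (by omega)
  have hck : ∀ k, c k = (∑ i ∈ Finset.range k, A ^ i) v := by
    intro k
    induction k with
    | zero => simp [h0]
    | succ k ih =>
      rw [hs, ih, Finset.sum_range_succ', pow_zero, LinearMap.add_apply, Module.End.one_apply,
        LinearMap.sum_apply, LinearMap.sum_apply, map_sum]
      simp [pow_succ']
  have hper : ∀ k, c (k + p ^ m) = c k := by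
    intro k
    induction k with
    | zero => rw [zero_add, hck, hsum, h0, LinearMap.zero_apply]
    | succ k ih => rw [add_right_comm, hs, hs, ih]
  have hsurj : Function.Surjective fun i : Fin (p ^ m) => c i := by
    intro w
    obtain ⟨k, rfl⟩ := hc w
    exact ⟨⟨k % p ^ m, Nat.mod_lt _ (pow_pos hp.out.pos m)⟩,
      (Function.Periodic.map_mod_nat hper k)⟩
  have hcard := Nat.card_le_card_of_surjective _ hsurj
  rw [natCard_eq_prime_pow_finrank (p := p), Nat.card_fin, hm] at hcard
  exact absurd hcard (not_le.2 (Nat.pow_lt_pow_right hp.out.one_lt (Nat.lt_succ_self m)))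

end LinearAlgebra

/-! ### Frattini quotient of a `p`-group -/

section Frattini

variable {p : ℕ} [hp : Fact p.Prime] {N : Type*} [Group N] [Finite N]

/-- By Sylow, a proper subgroup of order `p ^ k` lies in one of order `p ^ (k + 1)`, which
maximality forces to be `N`. -/
theorem IsPGroup.index_of_isCoatom (hN : IsPGroup p N) {M : Subgroup N} (hM : IsCoatom M) :
    M.index = p := by
  obtain ⟨k, hk⟩ := IsPGroup.iff_card.1 (hN.to_subgroup M)
  obtain ⟨n, hn⟩ := IsPGroup.iff_card.1 hN
  have hlt : k < n := by
    by_contra! h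
    have h1 : Nat.card N ≤ Nat.card M := by
      rw [hk, hn]; exact Nat.pow_le_pow_right hp.out.pos h
    exact hM.1 (Subgroup.eq_top_of_le_card M h1)
  obtain ⟨M', hM', hle⟩ := Sylow.exists_subgroup_card_pow_succ (p := p) (n := k)
    (by rw [hn]; exact pow_dvd_pow p hlt) hk
  have hne : M ≠ M' := by
    rintro rfl
    rw [hk] at hM'
    exact absurd (Nat.pow_right_injective hp.out.two_le hM') (by omega)
  have htop := hM.2 M' (lt_of_le_of_ne hle hne)
  rw [htop, Subgroup.card_top] at hM'
  have := M.card_mul_index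
  rw [hk, hM', pow_succ] at this
  exact Nat.eq_of_mul_eq_mul_left (pow_pos hp.out.pos k) this

theorem IsPGroup.normal_of_isCoatom (hN : IsPGroup p N) {M : Subgroup N} (hM : IsCoatom M) :
    M.Normal := by
  have h : Group.IsNilpotent N ↔ ∀ H : Subgroup N, IsCoatom H → H.Normal :=
    Group.isNilpotent_of_finite_tfae.out 0 2
  exact h.1 hN.isNilpotent M hM

omit [Finite N] in
theorem mem_frattini_iff {x : N} : x ∈ frattini N ↔ ∀ M : Subgroup N, IsCoatom M → x ∈ M := by
  simp [frattini, Order.radical, Subgroup.mem_iInf]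

theorem IsPGroup.pow_mem_frattini (hN : IsPGroup p N) (x : N) : x ^ p ∈ frattini N := by
  refine mem_frattini_iff.2 fun M hM => ?_
  have := hN.normal_of_isCoatom hM
  have := M.pow_index_mem x
  rwa [hN.index_of_isCoatom hM] at this

theorem IsPGroup.mul_inv_mem_frattini (hN : IsPGroup p N) (x y : N) :
    (x * y)⁻¹ * (y * x) ∈ frattini N := by
  refine mem_frattini_iff.2 fun M hM => ?_
  have := hN.normal_of_isCoatom hM
  have hc : Nat.card (N ⧸ M) = p := hN.index_of_isCoatom hM
  have := isCyclic_of_prime_card hc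
  rw [← QuotientGroup.eq, QuotientGroup.mk_mul, QuotientGroup.mk_mul]
  let := IsCyclic.commGroup (α := N ⧸ M)
  exact mul_comm (x : N ⧸ M) y

theorem isCyclic_of_isCyclic_quotient_frattini (h : IsCyclic (N ⧸ frattini N)) : IsCyclic N := by
  obtain ⟨g, hg⟩ := h
  obtain ⟨x, rfl⟩ := QuotientGroup.mk_surjective g
  refine ⟨x, fun y => ?_⟩
  have : Subgroup.zpowers x ⊔ frattini N = ⊤ := by
    rw [eq_top_iff]
    intro z _
    obtain ⟨k, hk⟩ := Subgroup.mem_zpowers_iff.1 (hg z)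
    rw [← QuotientGroup.mk_zpow, QuotientGroup.eq] at hk
    have := Subgroup.mul_mem_sup (Subgroup.zpow_mem_zpowers x k) hk
    rwa [mul_inv_cancel_left] at this
  exact Subgroup.mem_zpowers_iff.1 (frattini_nongenerating this ▸ Subgroup.mem_top y)

/-- `V` is the Frattini quotient written additively. Rank at most one would make it cyclic, and then
`N` too, as Frattini elements are nongenerators. -/
theorem IsPGroup.exists_elementary_quotient {N : Type uN} [Group N] [Finite N]
    (hN : IsPGroup p N) (hcyc : ¬ IsCyclic N) :
    ∃ (V : Type uN) (_ : AddCommGroup V) (_ : Module (ZMod p) V) (_ : Finite V) (π : N → V),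
      Function.Surjective π ∧ (∀ x y, π (x * y) = π x + π y) ∧
      2 ≤ Module.finrank (ZMod p) V ∧
      ∀ α : N ≃* N, ∃ A : Module.End (ZMod p) V, ∀ x, π (α x) = A (π x) := by
  let : CommGroup (N ⧸ frattini N) :=
    { (inferInstance : Group (N ⧸ frattini N)) with
      mul_comm := by
        intro a b
        obtain ⟨x, rfl⟩ := QuotientGroup.mk_surjective a
        obtain ⟨y, rfl⟩ := QuotientGroup.mk_surjective b
        exact QuotientGroup.eq.2 (hN.mul_inv_mem_frattini x y) }
  let : Module (ZMod p) (Additive (N ⧸ frattini N)) := AddCommGroup.zmodModule fun a => by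
    obtain ⟨x, hx⟩ := QuotientGroup.mk_surjective a.toMul
    apply Additive.toMul.injective
    rw [toMul_nsmul, ← hx, ← QuotientGroup.mk_pow, toMul_zero]
    exact (QuotientGroup.eq_one_iff _).2 (hN.pow_mem_frattini x)
  have : Finite (Additive (N ⧸ frattini N)) := inferInstanceAs (Finite (N ⧸ frattini N))
  refine ⟨Additive (N ⧸ frattini N), inferInstance, inferInstance, inferInstance,
    fun x => Additive.ofMul (x : N ⧸ frattini N), ?_, fun _ _ => rfl, ?_, fun α => ?_⟩
  · exact Additive.ofMul.surjective.comp QuotientGroup.mk_surjective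
  · by_contra! hlt
    have hcard : Nat.card (N ⧸ frattini N) =
        p ^ Module.finrank (ZMod p) (Additive (N ⧸ frattini N)) :=
      natCard_eq_prime_pow_finrank (V := Additive (N ⧸ frattini N))
    apply hcyc
    apply isCyclic_of_isCyclic_quotient_frattini
    generalize Module.finrank (ZMod p) (Additive (N ⧸ frattini N)) = d at hcard hlt
    interval_cases d
    · have := (Nat.card_eq_one_iff_unique.1 hcard).1
      infer_instance
    · exact isCyclic_of_prime_card (hcard.trans (pow_one p))
  · refine ⟨(QuotientGroup.map (frattini N) (frattini N) α.toMonoidHom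
      (frattini_le_comap_frattini_of_surjective α.surjective)).toAdditive.toZModLinearMap p,
      fun x => rfl⟩

end Frattini

/-! ### Regular actions and their normalizers -/

section RegularActions

variable {X : Type*}

/-- `θ` is a regular action of `N` on `X`. -/
def IsRegularAction {N : Type*} [Group N] (θ : N →* Equiv.Perm X) : Prop :=
  ∀ x, Function.Bijective fun n => θ n x

/-- Conjugation by the permutation `g` preserves the image of `θ`. -/
def Normalizes {N : Type*} [Group N] (g : Equiv.Perm X) (θ : N →* Equiv.Perm X) : Prop :=
  ∀ n, ∃ n', g * θ n = θ n' * g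

variable {N : Type*} [Group N] {θ : N →* Equiv.Perm X}

theorem IsRegularAction.injective (hθ : IsRegularAction θ) [Nonempty X] :
    Function.Injective θ := fun _ _ h =>
  (hθ (Classical.arbitrary X)).1 (congrArg (fun f : Equiv.Perm X => f _) h)

theorem IsRegularAction.exists_mulEquiv [Finite N] [Nonempty X] (hθ : IsRegularAction θ)
    {g : Equiv.Perm X} (hg : Normalizes g θ) :
    ∃ α : N ≃* N, ∀ n, g * θ n = θ (α n) * g := by
  choose α hα using hg
  have hmul : ∀ m n, α (m * n) = α m * α n := by
    intro m n
    apply hθ.injective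
    apply mul_right_cancel (b := g)
    rw [← hα, map_mul, map_mul, mul_assoc, ← hα, ← mul_assoc, ← mul_assoc, hα]
  have hinj : Function.Injective α := by
    intro m n h
    apply hθ.injective
    apply mul_left_cancel (a := g)
    rw [hα, hα, h]
  exact ⟨MulEquiv.ofBijective (MonoidHom.mk' α hmul) (Finite.injective_iff_bijective.1 hinj), hα⟩

/-- Identifying `X` with `N` through `x₀` turns `g` into `n ↦ α n * c (g x₀)`, which becomes affine
on the Frattini quotient. -/
theorem IsRegularAction.isCyclic_of_normalizes {p : ℕ} [hp : Fact p.Prime] (hodd : p ≠ 2)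
    [Finite N] (hN : IsPGroup p N) (hθ : IsRegularAction θ) {g : Equiv.Perm X}
    (hg : Normalizes g θ) (M : ℕ) (hgM : g ^ (p ^ M) = 1) (x₀ : X)
    (htrans : ∀ x, ∃ k : ℕ, (g ^ k) x₀ = x) : IsCyclic N := by
  by_contra hcyc
  have : Nonempty X := ⟨x₀⟩
  obtain ⟨V, _, _, _, π, hπ, hπmul, hrank, hA⟩ := hN.exists_elementary_quotient hcyc
  obtain ⟨α, hα⟩ := hθ.exists_mulEquiv hg
  obtain ⟨A, hA⟩ := hA α
  choose c hc using fun x => (hθ x₀).2 x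
  replace hc : ∀ x, θ (c x) x₀ = x := hc
  have hcθ : ∀ n, c (θ n x₀) = n := fun n => (hθ x₀).1 (hc _)
  have hgpow : ∀ (k : ℕ) n, ∃ n', g ^ k * θ n = θ n' * g ^ k ∧ π n' = (A ^ k) (π n) := by
    intro k n
    induction k with
    | zero => exact ⟨n, by simp, by simp⟩
    | succ k ih =>
      obtain ⟨n', h1, h2⟩ := ih
      refine ⟨α n', ?_, ?_⟩
      · rw [pow_succ', mul_assoc, h1, ← mul_assoc, hα, mul_assoc]
      · rw [hA, h2, pow_succ', Module.End.mul_apply]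
  have hAM : A ^ (p ^ M) = 1 := by
    ext v
    obtain ⟨n, rfl⟩ := hπ v
    obtain ⟨n', h1, h2⟩ := hgpow (p ^ M) n
    rw [hgM, one_mul, mul_one] at h1
    rw [← h2, ← hθ.injective h1, Module.End.one_apply]
  have hπ1 : π 1 = 0 := by simpa using hπmul 1 1
  refine absurd (finrank_lt_two_of_affine_orbit hodd A M hAM (π (c (g x₀)))
    (fun k => π (c ((g ^ k) x₀))) ?_ ?_ ?_) (not_lt.2 hrank)
  · have : c x₀ = 1 := by simpa using hcθ 1
    simpa [this] using hπ1
  · intro k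
    rw [← hA, ← hπmul]
    congr 1
    apply (hθ x₀).1
    change θ _ x₀ = θ _ x₀
    rw [hc, map_mul, Equiv.Perm.mul_apply, hc, ← Equiv.Perm.mul_apply, ← hα,
      Equiv.Perm.mul_apply, hc, pow_succ', Equiv.Perm.mul_apply]
  · intro v
    obtain ⟨n, rfl⟩ := hπ v
    obtain ⟨k, hk⟩ := htrans (θ n x₀)
    exact ⟨k, by simp only [hk, hcθ]⟩

end RegularActions

/-! ### Transitive groups normalizing a regular cyclic group -/

section CyclicActions

/-- `p ^ n` divides the index of `S ⊓ P`, while the index of `P` is prime to `p`; so `p ^ n` divides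
the size of the `P`-orbit. -/
theorem Sylow.exists_apply_eq {p : ℕ} [hp : Fact p.Prime] {X : Type*} {n : ℕ}
    (hX : Nat.card X = p ^ n) {G : Type*} [Group G] [Finite G] [MulAction G X]
    [MulAction.IsPretransitive G X] (P : Sylow p G) (x y : X) : ∃ g ∈ P, g • x = y := by
  set S := MulAction.stabilizer G x
  have hS : S.index = p ^ n := by rw [MulAction.index_stabilizer_of_transitive, hX]
  have : Finite X := Nat.finite_of_card_ne_zero (by rw [hX]; exact pow_ne_zero _ hp.out.ne_zero)
  have hcop : Nat.Coprime (p ^ n) (P : Subgroup G).index :=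
    Nat.Coprime.pow_left _ ((hp.out.coprime_iff_not_dvd).2 P.not_dvd_index)
  have h1 : S.relIndex P * (P : Subgroup G).index = (S ⊓ P).index := by
    rw [← Subgroup.inf_relIndex_right, Subgroup.relIndex_mul_index inf_le_right]
  have h2 : p ^ n ∣ S.relIndex P := by
    apply hcop.dvd_of_dvd_mul_right
    rw [h1, ← hS]
    exact Subgroup.index_dvd_of_le inf_le_left
  have h3 : (MulAction.orbit P x).ncard = S.relIndex P := by
    rw [← MulAction.index_stabilizer]
    rfl
  have h4 : MulAction.orbit P x = Set.univ := by
    apply Set.eq_of_subset_of_ncard_le (Set.subset_univ _)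
    rw [Set.ncard_univ, hX, h3]
    refine Nat.le_of_dvd ?_ h2
    exact Nat.pos_of_ne_zero Subgroup.FiniteIndex.index_ne_zero
  obtain ⟨g, hg⟩ : y ∈ MulAction.orbit P x := h4 ▸ Set.mem_univ y
  exact ⟨g, g.2, hg⟩

/-- Since `u` is 1 modulo `p`, lifting the exponent gives the sum `p`-adic valuation exactly `n`. -/
theorem ZMod.geom_sum_ne_zero {p : ℕ} [hp : Fact p.Prime] (hodd : p ≠ 2) (n : ℕ)
    (u : ZMod (p ^ (n + 1))) (M : ℕ) (hu : u ^ (p ^ M) = 1) :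
    ∑ i ∈ Finset.range (p ^ n), u ^ i ≠ 0 := by
  have : NeZero (p ^ (n + 1)) := ⟨pow_ne_zero _ hp.out.ne_zero⟩
  -- A lift above 1 keeps `a - 1` nonzero, so its valuation is finite and cancels.
  obtain ⟨a, ha1, rfl⟩ : ∃ a : ℕ, 1 < a ∧ (a : ZMod (p ^ (n + 1))) = u := by
    refine ⟨u.val + 2 * p ^ (n + 1), ?_, by simp⟩
    have : 1 ≤ p ^ (n + 1) := Nat.one_le_pow _ _ hp.out.pos
    omega
  intro h
  have hdvd : p ^ (n + 1) ∣ ∑ i ∈ Finset.range (p ^ n), a ^ i := by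
    rw [← ZMod.natCast_eq_zero_iff]; exact_mod_cast h
  have hap : (a : ZMod p) = 1 := by
    have := congrArg (ZMod.castHom (dvd_pow_self p (Nat.succ_ne_zero n)) (ZMod p)) hu
    simpa [ZMod.pow_card_pow] using this
  have hpa : (p : ℤ) ∣ a - 1 := by
    rw [← ZMod.intCast_zmod_eq_zero_iff_dvd]; simp [hap]
  have hpa' : ¬ (p : ℤ) ∣ a := by
    rw [← ZMod.intCast_zmod_eq_zero_iff_dvd]; simp [hap]
  have hlte := Int.emultiplicity_pow_sub_pow hp.out (hp.out.odd_of_ne_two hodd) hpa hpa' (p ^ n)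
  have hgs := geom_sum_mul (a : ℤ) (p ^ n)
  rw [one_pow, ← hgs, emultiplicity_mul (Nat.prime_iff_prime_int.1 hp.out), add_comm,
    hp.out.emultiplicity_pow_self] at hlte
  have hfin : emultiplicity (p : ℤ) (a - 1) ≠ ⊤ := by
    rw [ne_eq, emultiplicity_eq_top, not_not]
    refine Int.finiteMultiplicity_iff.2 ⟨?_, by omega⟩
    simpa using hp.out.ne_one
  have h5 := WithTop.add_left_cancel hfin hlte
  have h6 : (p : ℤ) ^ (n + 1) ∣ ∑ i ∈ Finset.range (p ^ n), (a : ℤ) ^ i := by exact_mod_cast hdvd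
  have := le_emultiplicity_of_pow_dvd h6
  rw [h5] at this
  norm_cast at this
  omega

theorem ZMod.map_eq_mul {q : ℕ} (α : Multiplicative (ZMod q) →* Multiplicative (ZMod q))
    (c : ZMod q) : α (.ofAdd c) = .ofAdd ((α (.ofAdd 1)).toAdd * c) := by
  obtain ⟨k, rfl⟩ := ZMod.intCast_surjective c
  have h : (Multiplicative.ofAdd (k : ZMod q)) = Multiplicative.ofAdd 1 ^ k := by
    rw [← ofAdd_zsmul, zsmul_one]
  rw [h, map_zpow, ← ofAdd_toAdd (α _), ← ofAdd_zsmul, zsmul_eq_mul, toAdd_ofAdd, mul_comm]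

/-- A group of permutations of a set of odd prime power cardinality that is transitive and
normalizes a regular cyclic group contains a transitive element of `p`-power order. -/
theorem exists_transitive_element {p n : ℕ} [hp : Fact p.Prime] (hodd : p ≠ 2) {X : Type*}
    (hX : Nat.card X = p ^ (n + 1)) (G : Subgroup (Equiv.Perm X))
    (hG : ∀ x y, ∃ g ∈ G, g x = y)
    (θ : Multiplicative (ZMod (p ^ (n + 1))) →* Equiv.Perm X) (hθ : IsRegularAction θ)
    (hGθ : ∀ g ∈ G, Normalizes g θ) :
    ∃ g ∈ G, ∃ M, g ^ (p ^ M) = 1 ∧ ∃ x₀, ∀ x, ∃ k : ℕ, (g ^ k) x₀ = x := by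
  have hX0 : Nat.card X ≠ 0 := by rw [hX]; exact pow_ne_zero _ hp.out.ne_zero
  have : Finite X := Nat.finite_of_card_ne_zero hX0
  have : Nonempty X := (Nat.card_ne_zero.1 hX0).1
  have : NeZero (p ^ (n + 1)) := ⟨pow_ne_zero _ hp.out.ne_zero⟩
  have : MulAction.IsPretransitive G X := ⟨fun x y => by
    obtain ⟨g, hg, h⟩ := hG x y
    exact ⟨⟨g, hg⟩, h⟩⟩
  let x₀ : X := Classical.arbitrary X
  obtain ⟨P⟩ : Nonempty (Sylow p G) := inferInstance
  obtain ⟨⟨g, hgG⟩, hgP, hg⟩ := P.exists_apply_eq hX x₀ (θ (.ofAdd 1) x₀)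
  replace hg : g x₀ = θ (.ofAdd 1) x₀ := hg
  obtain ⟨M, hM⟩ := P.isPGroup' ⟨_, hgP⟩
  replace hM : g ^ (p ^ M) = 1 := congrArg (fun z : P => ((z : G) : Equiv.Perm X)) hM
  obtain ⟨α, hα⟩ := hθ.exists_mulEquiv (hGθ g hgG)
  set u : ZMod (p ^ (n + 1)) := (α (.ofAdd 1)).toAdd with hu
  have hαu : ∀ c, α (.ofAdd c) = .ofAdd (u * c) := ZMod.map_eq_mul α.toMonoidHom
  have hpow : ∀ k : ℕ, g ^ k * θ (.ofAdd 1) = θ (.ofAdd (u ^ k)) * g ^ k := by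
    intro k
    induction k with
    | zero => simp
    | succ k ih => rw [pow_succ', mul_assoc, ih, ← mul_assoc, hα, hαu, mul_assoc, ← pow_succ']
  have huM : u ^ (p ^ M) = 1 := by
    have h := hpow (p ^ M)
    rw [hM, one_mul, mul_one] at h
    exact (Multiplicative.ofAdd.injective (hθ.injective h)).symm
  have horb : ∀ k : ℕ, (g ^ k) x₀ = θ (.ofAdd (∑ i ∈ Finset.range k, u ^ i)) x₀ := by
    intro k
    induction k with
    | zero => simp
    | succ k ih =>
      rw [pow_succ', Equiv.Perm.mul_apply, ih, ← Equiv.Perm.mul_apply, hα, hαu,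
        Equiv.Perm.mul_apply, hg, ← Equiv.Perm.mul_apply, ← map_mul, ← ofAdd_add,
        Finset.sum_range_succ', pow_zero, Finset.mul_sum]
      simp only [pow_succ']
  refine ⟨g, hgG, M, hM, x₀, ?_⟩
  -- The period is a power of `p`; a smaller one would divide `p ^ n` and make the geometric sum
  -- vanish.
  have hper : p ^ (n + 1) ∣ Function.minimalPeriod g x₀ := by
    have hdvd : Function.minimalPeriod g x₀ ∣ p ^ M := by
      apply Function.IsPeriodicPt.minimalPeriod_dvd
      change g^[p ^ M] x₀ = x₀
      rw [Equiv.Perm.iterate_eq_pow, hM, Equiv.Perm.one_apply]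
    obtain ⟨j, -, hj⟩ := (Nat.dvd_prime_pow hp.out).1 hdvd
    rw [hj]
    apply pow_dvd_pow
    by_contra! hjn
    have h1 : g^[p ^ n] x₀ = x₀ := by
      apply Function.isPeriodicPt_iff_minimalPeriod_dvd.2
      rw [hj]
      exact pow_dvd_pow p (by omega)
    rw [Equiv.Perm.iterate_eq_pow, horb] at h1
    have h2 : θ (.ofAdd (∑ i ∈ Finset.range (p ^ n), u ^ i)) x₀ = θ 1 x₀ := by
      rw [h1, map_one, Equiv.Perm.one_apply]
    exact ZMod.geom_sum_ne_zero hodd n u M huM (Multiplicative.ofAdd.injective ((hθ x₀).1 h2))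
  have hpos : 0 < Function.minimalPeriod g x₀ := by
    apply Function.IsPeriodicPt.minimalPeriod_pos (pow_pos hp.out.pos M)
    change g^[p ^ M] x₀ = x₀
    rw [Equiv.Perm.iterate_eq_pow, hM, Equiv.Perm.one_apply]
  have hle := Nat.le_of_dvd hpos hper
  have hinj : Function.Injective fun i : Fin (p ^ (n + 1)) => g^[i] x₀ := fun i j h =>
    Fin.ext (Function.iterate_injOn_Iio_minimalPeriod (i.2.trans_le hle) (j.2.trans_le hle) h)
  intro x
  obtain ⟨i, hi⟩ := (hinj.bijective_of_nat_card_le (by rw [hX, Nat.card_fin])).2 x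
  exact ⟨i, by rw [← Equiv.Perm.iterate_eq_pow]; exact hi⟩

/-- A transitive group of permutations of a set of odd prime power cardinality that normalizes a
regular cyclic group normalizes no noncyclic regular group. -/
theorem isCyclic_of_normalizes_regular_cyclic {p n : ℕ} (hp : p.Prime) (hodd : p ≠ 2)
    {X : Type*} (hX : Nat.card X = p ^ (n + 1)) (G : Subgroup (Equiv.Perm X))
    (hG : ∀ x y, ∃ g ∈ G, g x = y)
    (θ : Multiplicative (ZMod (p ^ (n + 1))) →* Equiv.Perm X) (hθ : IsRegularAction θ)
    (hGθ : ∀ g ∈ G, Normalizes g θ) {N : Type*} [Group N]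
    (η : N →* Equiv.Perm X) (hη : IsRegularAction η) (hGη : ∀ g ∈ G, Normalizes g η) :
    IsCyclic N := by
  have : Fact p.Prime := ⟨hp⟩
  obtain ⟨g, hgG, M, hM, x₀, hx₀⟩ := exists_transitive_element hodd hX G hG θ hθ hGθ
  have hN : Nat.card N = p ^ (n + 1) := by rw [← hX, Nat.card_congr (Equiv.ofBijective _ (hη x₀))]
  have : Finite N := Nat.finite_of_card_ne_zero (by rw [hN]; exact pow_ne_zero _ hp.ne_zero)
  exact hη.isCyclic_of_normalizes hodd (IsPGroup.of_card hN) (hGη g hgG) M hM x₀ hx₀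

end CyclicActions

/-! ### Galois action on the embeddings -/

section GaloisAction

variable (K L E : Type*) [Field K] [Field L] [Algebra K L] [Field E] [Algebra K E]

/-- The action of the automorphism group of `E / K` on the algebra homomorphisms `L → E`. -/
def galoisPerm : (E ≃ₐ[K] E) →* Equiv.Perm (L →ₐ[K] E) :=
  MonoidHom.toHomPerm
    { toFun σ φ := (σ : E →ₐ[K] E).comp φ
      map_one' := rfl
      map_mul' _ _ := rfl }

theorem galoisPerm_apply_toLinearMap (σ : E ≃ₐ[K] E) (φ : L →ₐ[K] E) :
    (galoisPerm K L E σ φ).toLinearMap = σ.toLinearMap ∘ₗ φ.toLinearMap := rfl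

theorem exists_galoisPerm_apply_eq [Normal K E] (φ ψ : L →ₐ[K] E) :
    ∃ σ, galoisPerm K L E σ φ = ψ := by
  let := φ.toRingHom.toAlgebra
  have : IsScalarTower K L E := IsScalarTower.of_algebraMap_eq fun x => (φ.commutes x).symm
  refine ⟨AlgEquiv.ofBijective (ψ.liftNormal E)
    (Algebra.IsAlgebraic.algHom_bijective (ψ.liftNormal E)), AlgHom.ext fun x => ?_⟩
  exact ψ.liftNormal_commutes E x

end GaloisAction

/-! ### From Hopf Galois structures to regular actions -/

namespace HopfGaloisStructure

variable {K L E H : Type*} [Field K] [Field L] [Algebra K L] [Field E] [Algebra K E]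
  [Ring H] [HopfAlgebra K H] (S : HopfGaloisStructure K L H)

/-- The action of `E ⊗ H` on `K`-linear maps `L → E`: the element `e ⊗ h` sends `φ` to
`y ↦ e * φ (h · y)`. -/
noncomputable def homAct (φ : L →ₗ[K] E) : E ⊗[K] H →ₗ[E] (L →ₗ[K] E) :=
  LinearMap.liftBaseChange E (LinearMap.compRight K φ ∘ₗ S.act.toLinearMap)

@[simp]
theorem homAct_tmul (φ : L →ₗ[K] E) (e : E) (h : H) (y : L) :
    S.homAct φ (e ⊗ₜ h) y = e * φ (S.act h y) := by
  simp [homAct]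

theorem homAct_add_left (φ ψ : L →ₗ[K] E) (w : E ⊗[K] H) :
    S.homAct (φ + ψ) w = S.homAct φ w + S.homAct ψ w := by
  induction w with
  | zero => simp
  | add a b ha hb => rw [map_add, ha, hb, map_add, map_add]; abel
  | tmul e h => ext y; simp [mul_add]

theorem homAct_zero_left (w : E ⊗[K] H) : S.homAct (0 : L →ₗ[K] E) w = 0 := by
  simpa using S.homAct_add_left (0 : L →ₗ[K] E) 0 w

/-- Precomposition makes this a right action, whence the inverse in `perm`. -/
theorem homAct_mul (φ : L →ₗ[K] E) (v w : E ⊗[K] H) :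
    S.homAct φ (v * w) = S.homAct (S.homAct φ v) w := by
  induction v with
  | zero => simp [homAct_zero_left]
  | add a b ha hb => rw [add_mul, map_add, ha, hb, map_add, homAct_add_left]
  | tmul e h =>
    induction w with
    | zero => simp
    | add a b ha hb => rw [mul_add, map_add, ha, hb, map_add]
    | tmul f k => ext y; simp; ring

theorem homAct_one (φ : L →ₗ[K] E) : S.homAct φ (1 : E ⊗[K] H) = φ := by
  ext y
  simp [Algebra.TensorProduct.one_def]

theorem homAct_apply_one (φ : L →ₐ[K] E) (w : E ⊗[K] H) :
    S.homAct φ.toLinearMap w 1 = Coalgebra.counit (R := E) w := by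
  induction w with
  | zero => simp
  | add a b ha hb => rw [map_add, map_add, LinearMap.add_apply, ha, hb]
  | tmul e h => simp [S.act_one, Algebra.smul_def, mul_comm]

/-- The bilinear form describing the action of `E ⊗ H` on a product. -/
noncomputable def homActMul (φ : L →ₗ[K] E) (x y : L) :
    (E ⊗[K] H) ⊗[E] (E ⊗[K] H) →ₗ[E] E :=
  TensorProduct.lift ((LinearMap.mul E E).compl₁₂
    (LinearMap.applyₗ' E x ∘ₗ S.homAct φ) (LinearMap.applyₗ' E y ∘ₗ S.homAct φ))

theorem homAct_apply_mul (φ : L →ₐ[K] E) (w : E ⊗[K] H) (x y : L) :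
    S.homAct φ.toLinearMap w (x * y) =
      S.homActMul φ.toLinearMap x y (Coalgebra.comul (R := E) w) := by
  induction w with
  | zero => simp
  | add a b ha hb => rw [map_add, map_add, map_add, LinearMap.add_apply, ha, hb]
  | tmul e h =>
    rw [TensorProduct.comul_tmul, homAct_tmul, S.act_mul]
    generalize Coalgebra.comul (R := K) h = t
    induction t with
    | zero => simp
    | add a b ha hb => simp only [map_add, mul_add, ha, hb, TensorProduct.tmul_add]
    | tmul h k => simp [homActMul]; ring

/-- Grouplike elements of `E ⊗ H` act on the algebra homomorphisms `L → E`. -/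
noncomputable def algHomAct {w : E ⊗[K] H} (hw : IsGroupLikeElem E w) (φ : L →ₐ[K] E) :
    L →ₐ[K] E :=
  AlgHom.ofLinearMap (S.homAct φ.toLinearMap w)
    (by rw [homAct_apply_one, hw.counit_eq_one])
    (fun x y => by
      rw [homAct_apply_mul, hw.comul_eq_tmul_self]
      simp [homActMul])

@[simp]
theorem algHomAct_toLinearMap {w : E ⊗[K] H} (hw : IsGroupLikeElem E w) (φ : L →ₐ[K] E) :
    (S.algHomAct hw φ).toLinearMap = S.homAct φ.toLinearMap w := rfl

theorem homAct_galois (σ : E ≃ₐ[K] E) (φ : L →ₗ[K] E) (w : E ⊗[K] H) :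
    σ.toLinearMap ∘ₗ S.homAct φ w =
      S.homAct (σ.toLinearMap ∘ₗ φ) (TensorProduct.map σ.toLinearMap LinearMap.id w) := by
  induction w with
  | zero => simp
  | add a b ha hb => rw [map_add, LinearMap.comp_add, ha, hb, map_add, map_add]
  | tmul e h => ext y; simp

include S in
theorem finrank_eq [FiniteDimensional K L] : Module.finrank K H = Module.finrank K L := by
  have := S.finite
  have h := (LinearEquiv.ofBijective _ S.bijective).finrank_eq
  rw [Module.finrank_tensorProduct, Module.finrank_linearMap] at h
  exact Nat.eq_of_mul_eq_mul_left Module.finrank_pos h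

theorem range_homAct_comp (φ : L →ₐ[K] E) (f : Module.End K L) :
    ∃ w : E ⊗[K] H, S.homAct φ.toLinearMap w = φ.toLinearMap ∘ₗ f := by
  obtain ⟨t, rfl⟩ := S.bijective.2 f
  refine ⟨TensorProduct.map φ.toLinearMap LinearMap.id t, ?_⟩
  induction t with
  | zero => simp
  | add a b ha hb => rw [map_add, map_add, ha, hb, map_add, LinearMap.comp_add]
  | tmul x h => ext y; simp

/-- The range contains `φ` composed with each coordinate projection onto `K`, and these span over
`E`. -/
theorem homAct_surjective [FiniteDimensional K L] (φ : L →ₐ[K] E) :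
    Function.Surjective (S.homAct φ.toLinearMap) := by
  intro g
  let b := Module.finBasis K L
  choose w hw using fun i => S.range_homAct_comp φ (LinearMap.toSpanSingleton K L 1 ∘ₗ b.coord i)
  refine ⟨∑ i, g (b i) • w i, ?_⟩
  apply b.ext
  intro j
  simp [hw, Finsupp.single_apply]

theorem homAct_injective [FiniteDimensional K L] (φ : L →ₐ[K] E) :
    Function.Injective (S.homAct φ.toLinearMap) := by
  have := S.finite
  have hfin : Module.finrank E (E ⊗[K] H) = Module.finrank E (L →ₗ[K] E) := by
    rw [Module.finrank_baseChange, S.finrank_eq, Module.finrank_linearMap_self]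
  exact (LinearMap.injective_iff_surjective_of_finrank_eq_finrank hfin).2 (S.homAct_surjective φ)

section GroupType

variable {N : Type*} [Group N] (Φ : (E ⊗[K] H) ≃ₐc[E] MonoidAlgebra E N)

theorem isGroupLikeElem_symm_of (n : N) :
    IsGroupLikeElem E (Φ.symm (MonoidAlgebra.of E N n)) :=
  (MonoidAlgebra.isGroupLikeElem_of n).map Φ.symm

/-- The action of `N` on the algebra homomorphisms `L → E` defined by a Hopf Galois structure of
type `N`. -/
noncomputable def perm : N →* Equiv.Perm (L →ₐ[K] E) :=
  MonoidHom.toHomPerm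
    { toFun n φ := S.algHomAct (isGroupLikeElem_symm_of Φ n⁻¹) φ
      map_one' := by
        funext φ
        apply AlgHom.toLinearMap_injective
        rw [algHomAct_toLinearMap, inv_one, map_one, map_one, homAct_one]
        rfl
      map_mul' m n := by
        funext φ
        apply AlgHom.toLinearMap_injective
        rw [algHomAct_toLinearMap, mul_inv_rev, map_mul, map_mul, homAct_mul]
        rfl }

theorem perm_apply_toLinearMap (n : N) (φ : L →ₐ[K] E) :
    (S.perm Φ n φ).toLinearMap =
      S.homAct φ.toLinearMap (Φ.symm (MonoidAlgebra.of E N n⁻¹)) := rfl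

/-- The `N`-translates of `φ` span all linear maps `L → E`, so by Dedekind independence no embedding
is missing. -/
theorem exists_perm_apply_eq [FiniteDimensional K L] (φ ψ : L →ₐ[K] E) :
    ∃ n, S.perm Φ n φ = ψ := by
  have htop : Submodule.span E (Set.range fun n => (S.perm Φ n φ).toLinearMap) = ⊤ := by
    rw [eq_top_iff]
    rintro g -
    obtain ⟨w, rfl⟩ := S.homAct_surjective φ g
    obtain ⟨a, rfl⟩ : ∃ a, Φ.symm a = w := ⟨Φ w, Φ.symm_apply_apply w⟩
    induction a using MonoidAlgebra.induction_on with
    | of n =>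
      refine Submodule.subset_span ⟨n⁻¹, ?_⟩
      simp only [perm_apply_toLinearMap, inv_inv]
    | add a b ha hb => rw [map_add, map_add]; exact Submodule.add_mem _ ha hb
    | smul e a ha => rw [map_smul, map_smul]; exact Submodule.smul_mem _ e ha
  by_contra! hne
  have hli := linearIndependent_algHom_toLinearMap K L E
  refine hli.notMem_span_image (s := Set.range fun n => S.perm Φ n φ) (x := ψ) ?_ ?_
  · rintro ⟨n, hn⟩
    exact hne n hn
  · rw [← Set.range_comp]
    exact htop ▸ Submodule.mem_top

theorem perm_isRegularAction [FiniteDimensional K L] : IsRegularAction (S.perm Φ) := by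
  refine fun φ => ⟨fun m n h => ?_, S.exists_perm_apply_eq Φ φ⟩
  have h1 := S.homAct_injective φ (congrArg AlgHom.toLinearMap h)
  exact inv_injective (MonoidAlgebra.of_injective (Φ.symm.injective h1))

theorem perm_normalizes [FiniteDimensional K L] (σ : E ≃ₐ[K] E) :
    Normalizes (galoisPerm K L E σ) (S.perm Φ) := by
  intro n
  rcases isEmpty_or_nonempty (L →ₐ[K] E) with h | ⟨⟨φ₀⟩⟩
  · exact ⟨1, Equiv.ext fun φ => h.elim φ⟩
  obtain ⟨n', hn'⟩ := S.exists_perm_apply_eq Φ (galoisPerm K L E σ φ₀)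
    (galoisPerm K L E σ (S.perm Φ n φ₀))
  -- `n'` was chosen for `φ₀` only; injectivity of the action turns this into an identity in `E ⊗
  -- H`, valid for every `φ`.
  have hu : TensorProduct.map σ.toLinearMap LinearMap.id (Φ.symm (MonoidAlgebra.of E N n⁻¹)) =
      Φ.symm (MonoidAlgebra.of E N n'⁻¹) := by
    apply S.homAct_injective (galoisPerm K L E σ φ₀)
    rw [← perm_apply_toLinearMap, hn', galoisPerm_apply_toLinearMap, ← homAct_galois,
      galoisPerm_apply_toLinearMap, perm_apply_toLinearMap]
  refine ⟨n', Equiv.ext fun φ => AlgHom.toLinearMap_injective ?_⟩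
  rw [Equiv.Perm.mul_apply, Equiv.Perm.mul_apply, galoisPerm_apply_toLinearMap,
    perm_apply_toLinearMap, perm_apply_toLinearMap, homAct_galois, hu,
    galoisPerm_apply_toLinearMap]

end GroupType

end HopfGaloisStructure

/-- A Hopf Galois structure of type `N` gives a regular action of `N` on the embeddings of `L` in
its normal closure that is normalized by the Galois group. -/
theorem HasHopfGaloisStructureOfType.exists_isRegularAction {K : Type uK} {L : Type uL}
    {E : Type uE} [Field K] [Field L] [Algebra K L] [FiniteDimensional K L] [Field E] [Algebra K E]
    {N : Type uN} [Group N] (h : HasHopfGaloisStructureOfType.{w} K L E N) :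
    ∃ θ : N →* Equiv.Perm (L →ₐ[K] E), IsRegularAction θ ∧
      ∀ g ∈ (galoisPerm K L E).range, Normalizes g θ := by
  obtain ⟨H, _, _, ⟨S⟩, ⟨Φ⟩⟩ := h
  refine ⟨S.perm Φ, S.perm_isRegularAction Φ, ?_⟩
  rintro _ ⟨σ, rfl⟩
  exact S.perm_normalizes Φ σ

theorem mainTheorem1 {K : Type uK} {L : Type uL} {E : Type uE}
    [Field K] [Field L] [Algebra K L] [Algebra.IsSeparable K L]
    [Field E] [Algebra K E] [Algebra L E] [IsScalarTower K L E] [IsNormalClosure K L E]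
    (p n : ℕ) (hp : p.Prime) (hodd : p ≠ 2) (hn : 2 ≤ n)
    (hdeg : Module.finrank K L = p ^ n)
    (hcyc : HasHopfGaloisStructureOfType.{w} K L E (Multiplicative (ZMod (p ^ n)))) :
    ∀ (N : Type uN) [Group N], ¬ IsCyclic N →
      ¬ HasHopfGaloisStructureOfType.{w'} K L E N := by
  intro N _ hN hHGS
  obtain ⟨m, rfl⟩ : ∃ m, n = m + 1 := ⟨n - 1, by omega⟩
  have : FiniteDimensional K L :=
    Module.finite_of_finrank_pos (by rw [hdeg]; exact pow_pos hp.pos _)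
  have : Normal K E := IsNormalClosure.normal (K := L)
  have hX : Nat.card (L →ₐ[K] E) = p ^ (m + 1) := by
    rw [← hdeg]
    exact AlgHom.natCard_of_splits K L E IsNormalClosure.splits
  obtain ⟨θ, hθ, hGθ⟩ := hcyc.exists_isRegularAction
  obtain ⟨η, hη, hGη⟩ := hHGS.exists_isRegularAction
  refine hN (isCyclic_of_normalizes_regular_cyclic hp hodd hX (galoisPerm K L E).range ?_
    θ hθ hGθ η hη hGη)
  intro φ ψ
  obtain ⟨σ, hσ⟩ := exists_galoisPerm_apply_eq K L E φ ψ
  exact ⟨_, ⟨σ, rfl⟩, hσ⟩
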